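/- Let $R$ be an associative ring with unity and let $M$ be a left $R$-module. Let $\sigma[M]$ be the category of all $R$-modules isomorphic to a submodule of an $M$-generated module (an epimorphic image of a direct sum of copies of $M$). For a module $X$ put $Ann_M(X)=\bigcap\{\ker f\mid f\in Hom_R(M,X)\}$, and for submodules $K,L\subseteq M$ put $K_ML=\sum\{f(K)\mid f\in Hom_R(M,L)\}$. A fully invariant submodule $P\neq M$ is *prime in* $M$ if for all fully invariant $K,L\subseteq M$, $K_ML\subseteq P$ implies $K\subseteq P$ or $L\subseteq P$; $Spec^{Min}(M)$ is the set of minimal elements of the set of all submodules prime in $M$. The module $M$ is *semiprime* if $M\ne 0$ and for every fully invariant $K\subseteq M$, $K_MK=0$ implies $K=0$. It satisfies *ACC on annihilators* if the set of all submodules $\bigcap_{f\in X}\ker f$ with $X\subseteq End_R(M)$ satisfies the ascending chain condition. A module is *uniform* if it is nonzero and any two nonzero submodules of it have nonzero intersection. For $N\in\sigma[M]$, $Ass_M(N)$ is the set of all fully invariant submodules $K\ne M$ of $M$ for which there is a nonzero submodule $L\subseteq N$ such that $Ann_M(L')=K$ for all nonzero submodules $L'\subseteq L$. A hereditary torsion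 theory on $\sigma[M]$ is given by a class of (torsion) modules in $\sigma[M]$ closed under submodules, factor modules, direct sums and extensions in $\sigma[M]$; its torsion-free modules are the $X\in\sigma[M]$ that receive no nonzero homomorphism from a torsion module. Let $\chi(M)$ be the hereditary torsion theory with greatest torsion class among those for which $M$ is torsion-free. A module $N\in\sigma[M]$ is *$M$-singular* if $N\cong L/K$ with $L\in\sigma[M]$ and $K$ essential in $L$, and $X\in\sigma[M]$ is *non $M$-singular* if the sum of all images in $X$ of $M$-singular modules is $0$. **Theorem 2.7.** Assume that $M$ is projective in $\sigma[M]$ and semiprime, that $M$ satisfies ACC on annihilators, and that every nonzero submodule of $M$ contains a uniform submodule. Then a module in $\sigma[M]$ is $\chi(M)$-torsion-free if and only if it is non $M$-singular. Moreover, for every indecomposable $\chi(M)$-torsion-free injective module $E$ in $\sigma[M]$ there is $P\in Spec^{Min}(M)$ with $Ass_M(E)=\{P\}$, and $E\mapsto P$ induces a bijection from the set of isomorphism classes of such modules $E$ onto $Spec^{Min}(M)$. -/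

import Mathlib

universe u v

namespace SigmaCat

section Basic

variable (R : Type u) [Ring R] (M : Type v) [AddCommGroup M] [Module R M]

/-- `X` is `M`-generated: an epimorphic image of a direct sum of copies of `M`. -/
def IsGeneratedBy (X : Type v) [AddCommGroup X] [Module R X] : Prop :=
  ∃ (ι : Type v) (g : (ι →₀ M) →ₗ[R] X), Function.Surjective g

/-- `X` is an object of `σ[M]`: it is isomorphic to a submodule of an `M`-generated module. -/
def InSigma (X : Type v) [AddCommGroup X] [Module R X] : Prop :=
  ∃ (Y : Type v) (_ : AddCommGroup Y) (_ : Module R Y) (i : X →ₗ[R] Y),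
    IsGeneratedBy R M Y ∧ Function.Injective i

/-- `P` is projective with respect to all epimorphisms of `σ[M]`. -/
def IsProjectiveIn (P : Type v) [AddCommGroup P] [Module R P] : Prop :=
  InSigma R M P ∧
    ∀ (A B : Type v) [AddCommGroup A] [Module R A] [AddCommGroup B] [Module R B],
      InSigma R M A → InSigma R M B →
      ∀ (g : A →ₗ[R] B) (f : P →ₗ[R] B), Function.Surjective g →
        ∃ h : P →ₗ[R] A, g ∘ₗ h = f

/-- `E` is injective in `σ[M]`: an object of `σ[M]`, injective with respect to all
monomorphisms of `σ[M]`. -/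
def IsInjectiveIn (E : Type v) [AddCommGroup E] [Module R E] : Prop :=
  InSigma R M E ∧
    ∀ (A B : Type v) [AddCommGroup A] [Module R A] [AddCommGroup B] [Module R B],
      InSigma R M A → InSigma R M B →
      ∀ (i : A →ₗ[R] B) (f : A →ₗ[R] E), Function.Injective i →
        ∃ h : B →ₗ[R] E, h ∘ₗ i = f

/-- `K` is an essential submodule of `X`. -/
def IsEssential {R : Type u} [Ring R] {X : Type v} [AddCommGroup X] [Module R X]
    (K : Submodule R X) : Prop :=
  ∀ N : Submodule R X, N ⊓ K = ⊥ → N = ⊥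

/-- Uniform modules: nonzero, and any two nonzero submodules intersect nontrivially. -/
def IsUniform (X : Type v) [AddCommGroup X] [Module R X] : Prop :=
  Nontrivial X ∧ ∀ A B : Submodule R X, A ≠ ⊥ → B ≠ ⊥ → A ⊓ B ≠ ⊥

/-- Indecomposable modules: nonzero, and not a direct sum of two nonzero submodules. -/
def IsIndecomposable (X : Type v) [AddCommGroup X] [Module R X] : Prop :=
  Nontrivial X ∧ ∀ A B : Submodule R X, IsCompl A B → A = ⊥ ∨ B = ⊥

/-- `N` is `M`-singular: there is an exact sequence `0 → K → L → N → 0` in `σ[M]` with `K`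
essential in `L`. -/
def IsSingularIn (N : Type v) [AddCommGroup N] [Module R N] : Prop :=
  InSigma R M N ∧
    ∃ (L : Type v) (_ : AddCommGroup L) (_ : Module R L) (g : L →ₗ[R] N),
      InSigma R M L ∧ Function.Surjective g ∧ IsEssential (LinearMap.ker g)

/-- `Z(L)`, the sum of all images in `L` of `M`-singular modules. -/
def singularSubmodule (L : Type v) [AddCommGroup L] [Module R L] : Submodule R L :=
  sSup {K | ∃ (N : Type v) (_ : AddCommGroup N) (_ : Module R N) (f : N →ₗ[R] L),
    IsSingularIn R M N ∧ K = LinearMap.range f}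

/-- `L` is non `M`-singular. -/
def IsNonsingularIn (L : Type v) [AddCommGroup L] [Module R L] : Prop :=
  InSigma R M L ∧ singularSubmodule R M L = ⊥

/-- The annihilator `Ann_M(X)`: the intersection of the kernels of all homomorphisms `M → X`. -/
def annih (X : Type v) [AddCommGroup X] [Module R X] : Submodule R M :=
  ⨅ f : M →ₗ[R] X, LinearMap.ker f

variable {R M}

/-- The product `K_M L = ∑ {f(K) | f ∈ Hom_R(M, L)}` of two submodules of `M`. -/
def prodSub (K L : Submodule R M) : Submodule R M :=
  ⨆ f : M →ₗ[R] L, K.map (L.subtype ∘ₗ f)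

/-- `P` is prime in `M`. -/
def IsPrimeIn (P : Submodule R M) : Prop :=
  P ≠ ⊤ ∧ P.IsFullyInvariant ∧
    ∀ K L : Submodule R M, K.IsFullyInvariant → L.IsFullyInvariant →
      prodSub K L ≤ P → K ≤ P ∨ L ≤ P

/-- `N` is semiprime in `M`. -/
def IsSemiprimeIn (N : Submodule R M) : Prop :=
  N ≠ ⊤ ∧ N.IsFullyInvariant ∧
    ∀ K : Submodule R M, K.IsFullyInvariant → prodSub K K ≤ N → K ≤ N

variable (R M)

/-- `M` is a semiprime module: `0` is semiprime in `M`. -/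
def IsSemiprimeModule : Prop := IsSemiprimeIn (⊥ : Submodule R M)

/-- `Spec^Min(M)`: the minimal elements of the set of all submodules prime in `M`. -/
def MinSpec : Set (Submodule R M) := {P | Minimal IsPrimeIn P}

/-- The set `𝒜_M` of all submodules `⋂ {ker f | f ∈ X}` with `X ⊆ End_R(M)`. -/
def annihSet : Set (Submodule R M) :=
  {A | ∃ X : Set (Module.End R M), A = ⨅ f ∈ X, LinearMap.ker f}

/-- The ascending chain condition on annihilators: every ascending chain in `𝒜_M` becomes
stationary. -/
def ACCAnnih : Prop :=
  ∀ a : ℕ → Submodule R M, (∀ n, a n ∈ annihSet R M) → Monotone a →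
    ∃ n, ∀ m, n ≤ m → a m = a n

/-- `Ass_M(N)`: the proper fully invariant submodules `K` of `M` for which there is a nonzero
submodule `L` of `N` with `Ann_M(L') = K` for all nonzero submodules `L'` of `L`. -/
def Ass (N : Type v) [AddCommGroup N] [Module R N] : Set (Submodule R M) :=
  {K | K ≠ ⊤ ∧ K.IsFullyInvariant ∧ ∃ L : Submodule R N, L ≠ ⊥ ∧
    ∀ L' : Submodule R N, L' ≠ ⊥ → L' ≤ L → annih R M L' = K}

end Basic

section Torsion

/-- Hereditary torsion theories on `σ[M]`, given by their torsion classes: classes of modules in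
`σ[M]` closed under submodules, factor modules, direct sums and extensions in `σ[M]` (and hence
under isomorphisms). -/
structure HereditaryTorsionTheory (R : Type u) [Ring R] (M : Type v) [AddCommGroup M]
    [Module R M] where
  Torsion : ∀ (X : Type v) [AddCommGroup X] [Module R X], Prop
  inSigma : ∀ (X : Type v) [AddCommGroup X] [Module R X], Torsion X → InSigma R M X
  of_injective : ∀ (X Y : Type v) [AddCommGroup X] [Module R X] [AddCommGroup Y] [Module R Y]
    (f : X →ₗ[R] Y), Function.Injective f → Torsion Y → Torsion X
  of_surjective : ∀ (X Y : Type v) [AddCommGroup X] [Module R X] [AddCommGroup Y] [Module R Y]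
    (f : X →ₗ[R] Y), Function.Surjective f → Torsion X → Torsion Y
  directSum : ∀ (ι : Type v) (X : ι → Type v) [∀ i, AddCommGroup (X i)] [∀ i, Module R (X i)],
    (∀ i, Torsion (X i)) → Torsion (DirectSum ι X)
  extension : ∀ (X : Type v) [AddCommGroup X] [Module R X] (N : Submodule R X),
    InSigma R M X → Torsion N → Torsion (X ⧸ N) → Torsion X

variable {R : Type u} [Ring R] {M : Type v} [AddCommGroup M] [Module R M]

/-- The torsion-free class `𝔽_τ`: modules of `σ[M]` that receive no nonzero homomorphism from a
torsion module. -/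
def HereditaryTorsionTheory.TorsionFree (τ : HereditaryTorsionTheory R M)
    (X : Type v) [AddCommGroup X] [Module R X] : Prop :=
  InSigma R M X ∧
    ∀ (T : Type v) [AddCommGroup T] [Module R T], τ.Torsion T → ∀ f : T →ₗ[R] X, f = 0

/-- Hereditary torsion theories are ordered by inclusion of their torsion classes. -/
instance : LE (HereditaryTorsionTheory R M) :=
  ⟨fun τ ρ => ∀ (X : Type v) [AddCommGroup X] [Module R X], τ.Torsion X → ρ.Torsion X⟩

theorem InSigma.of_injective {X Y : Type v} [AddCommGroup X] [Module R X] [AddCommGroup Y]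
    [Module R Y] (f : X →ₗ[R] Y) (hf : Function.Injective f) (h : InSigma R M Y) :
    InSigma R M X := by
  obtain ⟨Z, _, _, i, hZ, hi⟩ := h
  exact ⟨Z, _, _, i ∘ₗ f, hZ, by simpa using hi.comp hf⟩

theorem InSigma.of_surjective {X Y : Type v} [AddCommGroup X] [Module R X] [AddCommGroup Y]
    [Module R Y] (f : X →ₗ[R] Y) (hf : Function.Surjective f) (h : InSigma R M X) :
    InSigma R M Y := by
  obtain ⟨Z, _, _, i, ⟨ι, g, hg⟩, hi⟩ := h
  let K := (LinearMap.ker f).map i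
  let p : X →ₗ[R] Z ⧸ K := K.mkQ ∘ₗ i
  have hp : LinearMap.ker f = LinearMap.ker p := by
    ext x
    simp [p, K, LinearMap.mem_ker, hi.eq_iff]
  let e : Y ≃ₗ[R] X ⧸ LinearMap.ker f := (f.quotKerEquivOfSurjective hf).symm
  refine ⟨Z ⧸ K, _, _, (LinearMap.ker f).liftQ p hp.le ∘ₗ e.toLinearMap,
    ⟨ι, K.mkQ ∘ₗ g, ?_⟩, ?_⟩
  · simpa using (K.mkQ_surjective).comp hg
  · have : Function.Injective ((LinearMap.ker f).liftQ p hp.le) := by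
      rw [← LinearMap.ker_eq_bot]
      exact Submodule.ker_liftQ_eq_bot _ _ _ hp.ge
    simpa using this.comp e.injective

theorem InSigma.directSum {ι : Type v} {X : ι → Type v} [∀ i, AddCommGroup (X i)]
    [∀ i, Module R (X i)] (h : ∀ i, InSigma R M (X i)) : InSigma R M (DirectSum ι X) := by
  classical
  choose Y iA iM j hY hj using h
  choose κ g hg using hY
  refine ⟨DirectSum ι Y, _, _, DirectSum.lmap j, ⟨Σ i, κ i,
    Finsupp.lsum ℕ fun s => DirectSum.lof R ι Y s.1 ∘ₗ g s.1 ∘ₗ Finsupp.lsingle s.2, ?_⟩, ?_⟩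
  · rw [← LinearMap.range_eq_top, eq_top_iff]
    rintro y -
    induction y using DirectSum.induction_on with
    | zero => exact zero_mem _
    | add x y hx hy => exact add_mem hx hy
    | of i y =>
      obtain ⟨z, rfl⟩ := hg i y
      induction z using Finsupp.induction_linear with
      | zero => simp
      | add a b ha hb => simpa using add_mem ha hb
      | single k m =>
        refine ⟨Finsupp.single ⟨i, k⟩ m, ?_⟩
        simp [DirectSum.lof_eq_of]
  · exact (DirectSum.lmap_injective _).2 hj

variable (R M)

/-- The torsion class of `χ(M)`: modules of `σ[M]` none of whose submodules maps nontrivially to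
`M`. That this is the torsion class of the greatest hereditary torsion theory on `σ[M]` for which
`M` is torsion-free is proved in `chi_isGreatest`. -/
def ChiTorsion (X : Type v) [AddCommGroup X] [Module R X] : Prop :=
  InSigma R M X ∧ ∀ (X' : Submodule R X) (f : X' →ₗ[R] M), f = 0

variable {R M}

theorem ChiTorsion.hom_eq_zero {X Z : Type v} [AddCommGroup X] [Module R X] [AddCommGroup Z]
    [Module R Z] (h : ChiTorsion R M X) (i : Z →ₗ[R] X) (hi : Function.Injective i)
    (f : Z →ₗ[R] M) : f = 0 := by
  let e := LinearEquiv.ofInjective i hi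
  have := h.2 _ (f ∘ₗ e.symm.toLinearMap)
  ext z
  simpa using LinearMap.congr_fun this (e z)

theorem ChiTorsion.of_injective {X Y : Type v} [AddCommGroup X] [Module R X] [AddCommGroup Y]
    [Module R Y] (f : X →ₗ[R] Y) (hf : Function.Injective f) (h : ChiTorsion R M Y) :
    ChiTorsion R M X :=
  ⟨h.1.of_injective f hf, fun X' g => h.hom_eq_zero (f ∘ₗ X'.subtype)
    (by simpa using hf.comp X'.subtype_injective) g⟩

theorem ChiTorsion.of_surjective {X Y : Type v} [AddCommGroup X] [Module R X] [AddCommGroup Y]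
    [Module R Y] (f : X →ₗ[R] Y) (hf : Function.Surjective f) (h : ChiTorsion R M X) :
    ChiTorsion R M Y := by
  refine ⟨h.1.of_surjective f hf, fun Y' g => ?_⟩
  let q : Y'.comap f →ₗ[R] Y' := f.restrict fun _ hx => hx
  have h0 := h.2 _ (g ∘ₗ q)
  ext ⟨y, hy⟩
  obtain ⟨x, rfl⟩ := hf y
  exact LinearMap.congr_fun h0 ⟨x, hy⟩

theorem ChiTorsion.extension {X : Type v} [AddCommGroup X] [Module R X] (N : Submodule R X)
    (hX : InSigma R M X) (hN : ChiTorsion R M N) (hQ : ChiTorsion R M (X ⧸ N)) :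
    ChiTorsion R M X := by
  refine ⟨hX, fun X' f => ?_⟩
  let p : X' →ₗ[R] X ⧸ N := N.mkQ ∘ₗ X'.subtype
  have hk : LinearMap.ker p ≤ LinearMap.ker f := by
    intro x hx
    let i : LinearMap.ker p →ₗ[R] N :=
      (X'.subtype ∘ₗ (LinearMap.ker p).subtype).codRestrict N fun z => by
        exact (Submodule.Quotient.mk_eq_zero N).1 z.2
    have hi : Function.Injective i := fun a b hab => by
      have := congrArg Subtype.val hab
      exact Subtype.ext (Subtype.ext this)
    exact LinearMap.congr_fun (hN.hom_eq_zero i hi (f ∘ₗ (LinearMap.ker p).subtype)) ⟨x, hx⟩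
  have h0 := hQ.hom_eq_zero ((LinearMap.ker p).liftQ p le_rfl)
    (by rw [← LinearMap.ker_eq_bot]; exact Submodule.ker_liftQ_eq_bot _ _ _ le_rfl)
    ((LinearMap.ker p).liftQ f hk)
  ext x
  exact LinearMap.congr_fun h0 (Submodule.Quotient.mk x)

theorem ChiTorsion.sup {X : Type v} [AddCommGroup X] [Module R X] {A B : Submodule R X}
    (hA : ChiTorsion R M A) (hB : ChiTorsion R M B) (hX : InSigma R M X) :
    ChiTorsion R M (A ⊔ B : Submodule R X) := by
  have hS : InSigma R M (A ⊔ B : Submodule R X) :=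
    hX.of_injective _ (A ⊔ B).subtype_injective
  let j : A →ₗ[R] (A ⊔ B : Submodule R X) := Submodule.inclusion le_sup_left
  let k : B →ₗ[R] (A ⊔ B : Submodule R X) := Submodule.inclusion le_sup_right
  refine ChiTorsion.extension (LinearMap.range j) hS
    (hA.of_surjective j.rangeRestrict j.surjective_rangeRestrict)
    (hB.of_surjective ((LinearMap.range j).mkQ ∘ₗ k) ?_)
  intro y
  obtain ⟨⟨x, hx⟩, rfl⟩ := Submodule.mkQ_surjective _ y
  obtain ⟨a, ha, b, hb, rfl⟩ := Submodule.mem_sup.1 hx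
  refine ⟨⟨b, hb⟩, ?_⟩
  refine (Submodule.Quotient.eq _).2 ⟨⟨-a, neg_mem ha⟩, ?_⟩
  ext
  simp [j, k]

theorem ChiTorsion.directSum {ι : Type v} {X : ι → Type v} [∀ i, AddCommGroup (X i)]
    [∀ i, Module R (X i)] (h : ∀ i, ChiTorsion R M (X i)) :
    ChiTorsion R M (DirectSum ι X) := by
  classical
  have hS : InSigma R M (DirectSum ι X) := InSigma.directSum fun i => (h i).1
  have key : ∀ x : DirectSum ι X, ∃ A : Submodule R (DirectSum ι X), x ∈ A ∧ ChiTorsion R M A := by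
    intro x
    induction x using DirectSum.induction_on with
    | zero =>
      refine ⟨⊥, zero_mem _, hS.of_injective _ (Submodule.subtype_injective _), fun X' f => ?_⟩
      ext z
      rw [Subsingleton.elim z 0]
      simp
    | of i x =>
      exact ⟨LinearMap.range (DirectSum.lof R ι X i), ⟨x, rfl⟩,
        (h i).of_surjective _ (LinearMap.surjective_rangeRestrict _)⟩
    | add x y hx hy =>
      obtain ⟨A, hxA, hA⟩ := hx
      obtain ⟨B, hyB, hB⟩ := hy
      exact ⟨A ⊔ B, Submodule.add_mem_sup hxA hyB, hA.sup hB hS⟩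
  refine ⟨hS, fun X' f => ?_⟩
  ext ⟨x, hx⟩
  obtain ⟨A, hxA, hA⟩ := key x
  exact LinearMap.congr_fun (hA.hom_eq_zero
    (Submodule.inclusion (inf_le_right : X' ⊓ A ≤ A)) (Submodule.inclusion_injective _)
    (f ∘ₗ Submodule.inclusion (inf_le_left : X' ⊓ A ≤ X'))) ⟨x, hx, hxA⟩

variable (R M)

/-- The hereditary torsion theory `χ(M)` cogenerated by `M`. -/
def chi : HereditaryTorsionTheory R M where
  Torsion X _ _ := ChiTorsion R M X
  inSigma _ _ _ h := h.1
  of_injective _ _ _ _ _ _ f hf h := h.of_injective f hf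
  of_surjective _ _ _ _ _ _ f hf h := h.of_surjective f hf
  directSum _ _ _ _ h := ChiTorsion.directSum h
  extension _ _ _ N hX hN hQ := ChiTorsion.extension N hX hN hQ

/-- `χ(M)` is the greatest hereditary torsion theory on `σ[M]` for which `M` is torsion-free. -/
theorem chi_isGreatest :
    IsGreatest {τ : HereditaryTorsionTheory R M | τ.TorsionFree M} (chi R M) := by
  refine ⟨⟨⟨M, _, _, LinearMap.id, ⟨PUnit, Finsupp.lapply PUnit.unit, fun m =>
    ⟨Finsupp.single PUnit.unit m, by simp⟩⟩, Function.injective_id⟩, ?_⟩, ?_⟩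
  · intro T _ _ hT f
    exact ChiTorsion.hom_eq_zero hT LinearMap.id Function.injective_id f
  · intro τ hτ X _ _ hX
    exact ⟨τ.inSigma X hX, fun X' f =>
      hτ.2 X' (τ.of_injective _ _ X'.subtype X'.subtype_injective hX) f⟩

end Torsion

section Classes

variable (R : Type u) [Ring R] (M : Type v) [AddCommGroup M] [Module R M]

/-- The indecomposable `τ`-torsion-free injective modules in `σ[M]`. -/
structure IndecInj (τ : HereditaryTorsionTheory R M) where
  carrier : ModuleCat.{v} R
  indecomposable : IsIndecomposable R carrier
  torsionFree : τ.TorsionFree carrier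
  injective : IsInjectiveIn R M carrier

variable {R M}

/-- Isomorphism of modules. -/
instance IndecInj.isoSetoid (τ : HereditaryTorsionTheory R M) : Setoid (IndecInj R M τ) where
  r E F := Nonempty (E.carrier ≃ₗ[R] F.carrier)
  iseqv :=
    { refl := fun _ => ⟨LinearEquiv.refl _ _⟩
      symm := fun ⟨e⟩ => ⟨e.symm⟩
      trans := fun ⟨e⟩ ⟨f⟩ => ⟨e.trans f⟩ }

/-- `𝓔_τ(M)`: the isomorphism classes of indecomposable `τ`-torsion-free injective modules in
`σ[M]`. -/
abbrev IndecInjClasses (τ : HereditaryTorsionTheory R M) :=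
  Quotient (IndecInj.isoSetoid τ)

end Classes

end SigmaCat

/-!
The key fact is `eq_bot_of_le_annih`: no nonzero submodule `U` of `M` lies in `Ann_M(U)`. Indeed, let
`N` be the sum of the images of `U` under endomorphisms. As `M` is projective in `σ[M]`, a map
`M → N` lifts to a direct sum of copies of `U`, so `N` lies in `Ann_M(N)`, that is `N_M N = 0`, and
`N = 0` by semiprimeness. It follows that `M` is retractable and that its endomorphism ring is
semiprime. With the chain condition on annihilators, the classical argument for semiprime rings
shows that no nonzero endomorphism has essential kernel, hence that `M` is non `M`-singular
(`IsSingularIn.hom_eq_zero`).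

So `M`-singular modules are `χ(M)`-torsion. Conversely, a `χ(M)`-torsion module is a quotient of
some `L ≤ M^(ι)` whose kernel is essential, since a submodule of `L` disjoint from the kernel would
embed into the torsion module and yet map nontrivially to `M`. Torsion and singular modules being
the same, the first claim follows.

As `M` is nonsingular, maps from uniform modules of `σ[M]` to `M` are zero or injective. By the chain
condition, each uniform submodule of `M` contains one, `U`, whose nonzero submodules all have the
same annihilator `P`. Such a `P` is a minimal prime (`HasConstAnnih.mem_minSpec`). If `U'` is another
such submodule and `U` is not inside `Ann_M(U')`, then `U` embeds into `U'`; as a consequence `P`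
determines `U` up to a common nonzero submodule, and the chain condition leaves only finitely many
such `P`. Their intersection is `0`, so that each minimal prime is one of them
(`exists_isUniformConst_of_mem_minSpec`).

An indecomposable injective object `E` of `σ[M]` is uniform, and if it is `χ(M)`-torsion-free, then
it contains some `U` as above, so that `Ass_M(E) = {P}`. Since `E` is determined by any nonzero
submodule, `P` determines `E`; and each such `U` embeds into a uniform injective object of `σ[M]`,
found as a direct summand of the largest submodule in `σ[M]` of an injective module.
-/

namespace SigmaCat

variable {R : Type u} [Ring R] {M : Type v} [AddCommGroup M] [Module R M]

/-! ### Objects of `σ[M]` -/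

theorem InSigma.finsupp (ι : Type v) : InSigma R M (ι →₀ M) :=
  ⟨_, _, _, LinearMap.id, ⟨ι, LinearMap.id, Function.surjective_id⟩, Function.injective_id⟩

theorem InSigma.self : InSigma R M M :=
  (InSigma.finsupp (R := R) (M := M) PUnit).of_injective
    (Finsupp.lsingle PUnit.unit) (Finsupp.single_injective _)

theorem InSigma.submodule {X : Type v} [AddCommGroup X] [Module R X] (h : InSigma R M X)
    (N : Submodule R X) : InSigma R M N :=
  h.of_injective N.subtype N.subtype_injective

theorem InSigma.range {X Y : Type v} [AddCommGroup X] [Module R X] [AddCommGroup Y] [Module R Y]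
    (h : InSigma R M X) (f : X →ₗ[R] Y) : InSigma R M (LinearMap.range f) :=
  h.of_surjective f.rangeRestrict f.surjective_rangeRestrict

/-! ### Annihilators -/

section Annih

variable {X Y : Type v} [AddCommGroup X] [Module R X] [AddCommGroup Y] [Module R Y]

theorem mem_annih {x : M} : x ∈ annih R M X ↔ ∀ f : M →ₗ[R] X, f x = 0 := by
  simp [annih]

theorem annih_fullyInvariant : (annih R M X).IsFullyInvariant := fun f _ hx =>
  mem_annih.2 fun g => mem_annih.1 hx (g ∘ₗ f)

theorem annih_le_of_injective (f : X →ₗ[R] Y) (hf : Function.Injective f) :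
    annih R M Y ≤ annih R M X := fun _ hx =>
  mem_annih.2 fun g => hf (by simpa using mem_annih.1 hx (f ∘ₗ g))

theorem annih_congr (e : X ≃ₗ[R] Y) : annih R M X = annih R M Y :=
  le_antisymm (annih_le_of_injective e.symm.toLinearMap e.symm.injective)
    (annih_le_of_injective e.toLinearMap e.injective)

theorem annih_mem_annihSet (U : Submodule R M) : annih R M U ∈ annihSet R M := by
  refine ⟨Set.range fun f : M →ₗ[R] U => U.subtype ∘ₗ f, ?_⟩
  ext x
  simp [mem_annih]

theorem ker_mem_annihSet (f : Module.End R M) : LinearMap.ker f ∈ annihSet R M :=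
  ⟨{f}, by simp⟩

theorem iInf_mem_annihSet {ι : Sort*} {a : ι → Submodule R M} (h : ∀ i, a i ∈ annihSet R M) :
    ⨅ i, a i ∈ annihSet R M := by
  choose X hX using h
  refine ⟨⋃ i, X i, ?_⟩
  rw [iInf_iUnion]
  exact iInf_congr hX

/-- Under the ascending chain condition, a nonempty family of annihilators has a member that
no other member properly contains. -/
theorem ACCAnnih.exists_maximal (hacc : ACCAnnih R M) {ι : Type*} [Nonempty ι]
    (a : ι → Submodule R M) (ha : ∀ i, a i ∈ annihSet R M) :
    ∃ i, ∀ j, a i ≤ a j → a j = a i := by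
  have : WellFoundedGT (annihSet R M) := by
    rw [wellFoundedGT_iff_monotone_chain_condition]
    intro b
    obtain ⟨n, hn⟩ := hacc (fun n => b n) (fun n => (b n).2) fun m n h => b.monotone h
    exact ⟨n, fun m hm => Subtype.ext (hn m hm).symm⟩
  let b : ι → annihSet R M := fun i => ⟨a i, ha i⟩
  obtain ⟨_, ⟨i, rfl⟩, hi⟩ := wellFounded_gt.has_min (Set.range b) (Set.range_nonempty b)
  exact ⟨i, fun j hij => (eq_of_le_of_not_lt hij (hi (b j) ⟨j, rfl⟩)).symm⟩

end Annih

/-! ### Semiprimeness: no nonzero submodule lies in its own annihilator -/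

/-- The smallest fully invariant submodule containing `U`. -/
def fullyInvariantClosure (U : Submodule R M) : Submodule R M :=
  ⨆ s : Module.End R M, U.map s

theorem le_fullyInvariantClosure (U : Submodule R M) : U ≤ fullyInvariantClosure U := fun x hx =>
  Submodule.mem_iSup_of_mem (p := fun s : Module.End R M => U.map s) LinearMap.id ⟨x, hx, rfl⟩

theorem fullyInvariantClosure_fullyInvariant (U : Submodule R M) :
    (fullyInvariantClosure U).IsFullyInvariant := by
  intro f
  refine iSup_le fun s => ?_
  rintro _ ⟨x, hx, rfl⟩
  exact Submodule.mem_iSup_of_mem (p := fun s : Module.End R M => U.map s) (f ∘ₗ s) ⟨x, hx, rfl⟩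

theorem fullyInvariantClosure_le {U K : Submodule R M} (hK : K.IsFullyInvariant) (h : U ≤ K) :
    fullyInvariantClosure U ≤ K :=
  iSup_le fun s => Submodule.map_le_iff_le_comap.2 (h.trans (hK s))

/-- Since `M` is projective, each map from `M` into the sum of the images `s(U)` lifts to the
direct sum of copies of `U`, so what kills all maps into `U` kills all maps into the sum. -/
theorem annih_le_annih_fullyInvariantClosure (hproj : IsProjectiveIn R M M) (U : Submodule R M) :
    annih R M U ≤ annih R M (fullyInvariantClosure U) := by
  classical
  let N := fullyInvariantClosure U
  have hN (s : Module.End R M) (x : U) : s x ∈ N :=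
    Submodule.mem_iSup_of_mem (p := fun s : Module.End R M => U.map s) s ⟨x, x.2, rfl⟩
  let g : (Module.End R M →₀ U) →ₗ[R] N :=
    Finsupp.lsum ℕ fun s => (s ∘ₗ U.subtype).codRestrict N (hN s)
  have hg : Function.Surjective g := by
    rw [← LinearMap.range_eq_top, ← Submodule.map_injective_of_injective N.subtype_injective
      |>.eq_iff, Submodule.map_subtype_top, ← LinearMap.range_comp]
    refine le_antisymm ?_ (iSup_le fun s => ?_)
    · rintro _ ⟨x, rfl⟩
      exact (g x).2
    · rintro _ ⟨x, hx, rfl⟩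
      exact ⟨Finsupp.single s ⟨x, hx⟩, by simp [g]; rfl⟩
  have hA : InSigma R M (Module.End R M →₀ U) :=
    (InSigma.finsupp (Module.End R M)).of_injective (Finsupp.mapRange.linearMap U.subtype)
      (Finsupp.mapRange_injective _ (map_zero _) U.subtype_injective)
  intro x hx
  refine mem_annih.2 fun f => ?_
  obtain ⟨h, rfl⟩ := hproj.2 _ _ hA (InSigma.self.submodule N) g f hg
  have : h x = 0 := by
    ext s
    simpa using congrArg Subtype.val (mem_annih.1 hx (Finsupp.lapply s ∘ₗ h))
  simp [this]

theorem prodSub_le_iff {K L N : Submodule R M} :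
    prodSub K L ≤ N ↔ ∀ f : M →ₗ[R] L, ∀ x ∈ K, (f x : M) ∈ N := by
  rw [prodSub, iSup_le_iff]
  exact forall_congr' fun f => Submodule.map_le_iff_le_comap

/-- For `U` with fully invariant closure `N`, the inclusion `U ≤ Ann_M(U)` gives `N_M N = 0`. -/
theorem eq_bot_of_le_annih (hproj : IsProjectiveIn R M M) (hsemi : IsSemiprimeModule R M)
    {U : Submodule R M} (h : U ≤ annih R M U) : U = ⊥ := by
  have h1 : fullyInvariantClosure U ≤ annih R M (fullyInvariantClosure U) :=
    (fullyInvariantClosure_le annih_fullyInvariant h).trans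
      (annih_le_annih_fullyInvariantClosure hproj U)
  have h2 := hsemi.2.2 _ (fullyInvariantClosure_fullyInvariant U) <| prodSub_le_iff.2
    fun f x hx => by simp [mem_annih.1 (h1 hx) f]
  exact le_bot_iff.1 ((le_fullyInvariantClosure U).trans h2)

/-- A module that is projective in `σ[M]` and semiprime is retractable: `Hom(M, U) ≠ 0` for each
nonzero `U ≤ M`. -/
theorem annih_ne_top (hproj : IsProjectiveIn R M M) (hsemi : IsSemiprimeModule R M)
    {U : Submodule R M} (hU : U ≠ ⊥) : annih R M U ≠ ⊤ := fun h =>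
  hU (eq_bot_of_le_annih hproj hsemi (h ▸ le_top))

/-- The endomorphism ring of `M` is semiprime. -/
theorem end_eq_zero_of_mul_mul_eq_zero (hproj : IsProjectiveIn R M M)
    (hsemi : IsSemiprimeModule R M) (a : Module.End R M) (h : ∀ s : Module.End R M, a * s * a = 0) :
    a = 0 := by
  rw [← LinearMap.range_eq_bot]
  refine eq_bot_of_le_annih hproj hsemi ?_
  rintro _ ⟨m, rfl⟩
  refine mem_annih.2 fun g => ?_
  obtain ⟨t, rfl⟩ := hproj.2 _ _ InSigma.self (InSigma.self.range a) a.rangeRestrict g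
    a.surjective_rangeRestrict
  exact Subtype.ext (LinearMap.congr_fun (h t) m)

/-! ### Singular modules -/

section Singular

variable {X Y : Type v} [AddCommGroup X] [Module R X] [AddCommGroup Y] [Module R Y]

theorem IsEssential.mono {K L : Submodule R X} (hK : IsEssential K) (h : K ≤ L) :
    IsEssential L := fun N hN => hK N (le_bot_iff.1 ((inf_le_inf_left N h).trans hN.le))

theorem IsEssential.comap {K : Submodule R Y} (hK : IsEssential K) (g : X →ₗ[R] Y) :
    IsEssential (K.comap g) := by
  intro N hN
  have h1 : N.map g = ⊥ := by
    refine hK _ (eq_bot_iff.2 ?_)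
    rintro _ ⟨⟨n, hn, rfl⟩, hk⟩
    have h0 : n ∈ N ⊓ K.comap g := ⟨hn, hk⟩
    rw [hN, Submodule.mem_bot] at h0
    simp [h0]
  rw [← hN]
  refine (inf_eq_left.2 fun n hn => ?_).symm
  have : g n ∈ N.map g := ⟨n, hn, rfl⟩
  rw [h1, Submodule.mem_bot] at this
  simp [this]

theorem IsSingularIn.of_surjective (h : IsSingularIn R M X) (f : X →ₗ[R] Y)
    (hf : Function.Surjective f) : IsSingularIn R M Y := by
  obtain ⟨hX, L, _, _, g, hL, hg, hk⟩ := h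
  refine ⟨hX.of_surjective f hf, L, _, _, f ∘ₗ g, hL, by simpa using hf.comp hg, hk.mono ?_⟩
  exact LinearMap.ker_le_ker_comp g f

theorem IsSingularIn.of_injective (h : IsSingularIn R M Y) (f : X →ₗ[R] Y)
    (hf : Function.Injective f) : IsSingularIn R M X := by
  obtain ⟨hY, L, _, _, g, hL, hg, hk⟩ := h
  let e := LinearEquiv.ofInjective f hf
  let L' := (LinearMap.range f).comap g
  let g' : L' →ₗ[R] LinearMap.range f := g.restrict fun _ hx => hx
  refine ⟨hY.of_injective f hf, L', _, _, e.symm.toLinearMap ∘ₗ g', hL.submodule L', ?_, ?_⟩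
  · refine e.symm.surjective.comp ?_
    rintro ⟨y, hy⟩
    obtain ⟨x, rfl⟩ := hg y
    exact ⟨⟨x, hy⟩, rfl⟩
  · have : LinearMap.ker (e.symm.toLinearMap ∘ₗ g') = (LinearMap.ker g).comap L'.subtype := by
      rw [LinearEquiv.ker_comp]
      ext x
      simp [g', LinearMap.restrict_apply, LinearMap.mem_ker]
    rw [this]
    exact hk.comap _

/-- By projectivity, a map from `M` to a singular module has essential kernel. -/
theorem IsSingularIn.ker_isEssential (hproj : IsProjectiveIn R M M) (h : IsSingularIn R M X)
    (f : M →ₗ[R] X) : IsEssential (LinearMap.ker f) := by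
  obtain ⟨hX, L, _, _, g, hL, hg, hk⟩ := h
  obtain ⟨t, rfl⟩ := hproj.2 _ _ hL hX g f hg
  rw [LinearMap.ker_comp]
  exact hk.comap t

/-- The endomorphisms with essential kernel vanish. A nonzero one, `a`, with maximal kernel
satisfies `a s a = 0` for each `s`: the kernel of `a s` meets the range of `a`, hence the kernel
of `a s a` is properly larger than that of `a`. -/
theorem end_eq_zero_of_ker_isEssential (hproj : IsProjectiveIn R M M)
    (hsemi : IsSemiprimeModule R M) (hacc : ACCAnnih R M) (a : Module.End R M)
    (ha : IsEssential (LinearMap.ker a)) : a = 0 := by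
  by_contra h0
  let ι := {f : Module.End R M // f ≠ 0 ∧ IsEssential (LinearMap.ker f)}
  have : Nonempty ι := ⟨⟨a, h0, ha⟩⟩
  obtain ⟨⟨f, hf, hk⟩, hmax⟩ := hacc.exists_maximal
    (fun f : ι => LinearMap.ker f.1) fun f => ker_mem_annihSet f.1
  refine hf (end_eq_zero_of_mul_mul_eq_zero hproj hsemi f fun s => ?_)
  by_contra hne
  have hle : LinearMap.ker f ≤ LinearMap.ker (f * s * f) := LinearMap.ker_le_ker_comp f (f * s)
  have heq := hmax ⟨f * s * f, hne, hk.mono hle⟩ hle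
  have hess : IsEssential (LinearMap.ker (f * s)) := hk.comap s
  refine hf (LinearMap.range_eq_bot.1 (hess _ (eq_bot_iff.2 ?_)))
  rintro _ ⟨⟨x, rfl⟩, hx⟩
  have : x ∈ LinearMap.ker (f * s * f) := hx
  rw [heq] at this
  exact this

/-- `M` is non `M`-singular. -/
theorem IsSingularIn.hom_eq_zero (hproj : IsProjectiveIn R M M) (hsemi : IsSemiprimeModule R M)
    (hacc : ACCAnnih R M) (h : IsSingularIn R M X) (f : X →ₗ[R] M) : f = 0 := by
  rw [← LinearMap.range_eq_bot]
  refine eq_bot_of_le_annih hproj hsemi fun x _ => mem_annih.2 fun g => ?_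
  have hs := (h.of_surjective f.rangeRestrict f.surjective_rangeRestrict).ker_isEssential hproj g
  have := end_eq_zero_of_ker_isEssential hproj hsemi hacc ((LinearMap.range f).subtype ∘ₗ g)
    (by rwa [LinearMap.ker_comp, Submodule.ker_subtype])
  exact Subtype.ext (LinearMap.congr_fun this x)

theorem IsSingularIn.chiTorsion (hproj : IsProjectiveIn R M M) (hsemi : IsSemiprimeModule R M)
    (hacc : ACCAnnih R M) (h : IsSingularIn R M X) : ChiTorsion R M X :=
  ⟨h.1, fun X' f =>
    (h.of_injective X'.subtype X'.subtype_injective).hom_eq_zero hproj hsemi hacc f⟩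

theorem isNonsingularIn_iff :
    IsNonsingularIn R M X ↔ InSigma R M X ∧
      ∀ K : Submodule R X, IsSingularIn R M K → K = ⊥ := by
  refine and_congr_right fun _ => ⟨fun h K hK => ?_, fun h => ?_⟩
  · rw [eq_bot_iff, ← h]
    exact le_sSup ⟨K, _, _, K.subtype, hK, by simp⟩
  · refine sSup_eq_bot.2 ?_
    rintro _ ⟨N, _, _, f, hN, rfl⟩
    exact h _ (hN.of_surjective f.rangeRestrict f.surjective_rangeRestrict)

/-- If no submodule of `X` maps nontrivially to `M`, then a map to `X` from a submodule `L` of a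
direct sum of copies of `M` has essential kernel: a nonzero `N ≤ L` meeting the kernel trivially
would embed into `X` and have a nonzero coordinate map to `M`. -/
theorem ChiTorsion.ker_isEssential (h : ChiTorsion R M X) {ι : Type v}
    {L : Submodule R (ι →₀ M)} (p : L →ₗ[R] X) : IsEssential (LinearMap.ker p) := by
  intro N hN
  have hj : Function.Injective (p ∘ₗ N.subtype) := (injective_iff_map_eq_zero _).2 fun n hn => by
    have : (n : L) ∈ N ⊓ LinearMap.ker p := ⟨n.2, hn⟩
    rw [hN] at this
    exact Subtype.ext this
  refine eq_bot_iff.2 fun n hn => (Submodule.mem_bot R).2 (Subtype.ext (Finsupp.ext fun k => ?_))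
  exact LinearMap.congr_fun (h.hom_eq_zero (Z := N) _ hj
    (Finsupp.lapply k ∘ₗ L.subtype ∘ₗ N.subtype)) ⟨n, hn⟩

theorem ChiTorsion.isSingularIn (h : ChiTorsion R M X) : IsSingularIn R M X := by
  obtain ⟨Y, _, _, i, ⟨ι, g, hg⟩, hi⟩ := h.1
  let e := LinearEquiv.ofInjective i hi
  let g' : (LinearMap.range i).comap g →ₗ[R] LinearMap.range i := g.restrict fun _ hx => hx
  refine ⟨h.1, _, _, _, e.symm.toLinearMap ∘ₗ g', (InSigma.finsupp ι).submodule _, ?_,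
    h.ker_isEssential _⟩
  refine e.symm.surjective.comp ?_
  rintro ⟨y, hy⟩
  obtain ⟨x, rfl⟩ := hg y
  exact ⟨⟨x, hy⟩, rfl⟩

theorem chi_torsionFree_iff_isNonsingularIn (hproj : IsProjectiveIn R M M)
    (hsemi : IsSemiprimeModule R M) (hacc : ACCAnnih R M) :
    (chi R M).TorsionFree X ↔ IsNonsingularIn R M X := by
  rw [isNonsingularIn_iff]
  refine and_congr_right fun _ => ⟨fun h K hK => ?_, fun h T _ _ hT f => ?_⟩
  · simpa using congrArg LinearMap.range (h K (hK.chiTorsion hproj hsemi hacc) K.subtype)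
  · rw [← LinearMap.range_eq_bot]
    exact h _ (ChiTorsion.isSingularIn
      (hT.of_surjective f.rangeRestrict f.surjective_rangeRestrict))

end Singular

/-! ### Uniform modules and constant annihilators -/

section Uniform

variable {V X : Type v} [AddCommGroup V] [Module R V] [AddCommGroup X] [Module R X]

theorem map_ne_bot_of_injective {f : V →ₗ[R] X} (hf : Function.Injective f) {K : Submodule R V}
    (hK : K ≠ ⊥) : K.map f ≠ ⊥ := by
  simpa using (Submodule.map_injective_of_injective hf).ne hK

theorem IsUniform.isEssential (h : IsUniform R X) {K : Submodule R X} (hK : K ≠ ⊥) :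
    IsEssential K := fun N hN => by
  by_contra hne
  exact h.2 N K hne hK hN

theorem IsUniform.of_injective (h : IsUniform R X) [Nontrivial V] (i : V →ₗ[R] X)
    (hi : Function.Injective i) : IsUniform R V := by
  refine ⟨‹_›, fun A B hA hB hAB => h.2 (A.map i) (B.map i) ?_ ?_ ?_⟩
  · exact map_ne_bot_of_injective hi hA
  · exact map_ne_bot_of_injective hi hB
  · rw [← Submodule.map_inf i hi, hAB, Submodule.map_bot]

theorem IsUniform.of_isEssential_range (h : IsUniform R V) (i : V →ₗ[R] X)
    (hi : Function.Injective i) (he : IsEssential (LinearMap.range i)) : IsUniform R X := by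
  have key : ∀ A : Submodule R X, A ≠ ⊥ → A.comap i ≠ ⊥ := fun A hA h0 => hA <| he A <| by
    rw [inf_comm, ← Submodule.map_comap_eq, h0, Submodule.map_bot]
  have := h.1
  refine ⟨hi.nontrivial, fun A B hA hB hAB => h.2 _ _ (key A hA) (key B hB) ?_⟩
  rw [← Submodule.comap_inf, hAB]
  exact LinearMap.ker_eq_bot.2 hi

/-- Maps from uniform modules to the nonsingular module `M` are injective or zero. -/
theorem IsUniform.injective_of_ne_zero (hproj : IsProjectiveIn R M M)
    (hsemi : IsSemiprimeModule R M) (hacc : ACCAnnih R M) (h : IsUniform R X)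
    (hX : InSigma R M X) {f : X →ₗ[R] M} (hf : f ≠ 0) : Function.Injective f := by
  rw [← LinearMap.ker_eq_bot]
  by_contra hk
  have hs : IsSingularIn R M (LinearMap.range f) := by
    refine ⟨hX.range f, X, _, _, f.rangeRestrict, hX, f.surjective_rangeRestrict, ?_⟩
    rw [LinearMap.ker_rangeRestrict]
    exact h.isEssential hk
  have h0 := congrArg LinearMap.range
    (hs.hom_eq_zero hproj hsemi hacc (LinearMap.range f).subtype)
  rw [Submodule.range_subtype, LinearMap.range_zero, LinearMap.range_eq_bot] at h0
  exact hf h0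

/-- `V` is nonzero and all of its nonzero submodules have `M`-annihilator `P`. -/
def HasConstAnnih (P : Submodule R M) (V : Type v) [AddCommGroup V] [Module R V] : Prop :=
  Nontrivial V ∧ ∀ L : Submodule R V, L ≠ ⊥ → annih R M L = P

theorem HasConstAnnih.annih_eq_of_injective {P : Submodule R M} (h : HasConstAnnih P X)
    [Nontrivial V] (i : V →ₗ[R] X) (hi : Function.Injective i) : annih R M V = P := by
  rw [annih_congr (LinearEquiv.ofInjective i hi)]
  refine h.2 _ fun h0 => ?_
  obtain ⟨v, hv⟩ := exists_ne (0 : V)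
  exact hv (hi (by rw [LinearMap.range_eq_bot.1 h0]; simp))

theorem HasConstAnnih.annih_eq {P : Submodule R M} (h : HasConstAnnih P X) : annih R M X = P :=
  have := h.1
  h.annih_eq_of_injective LinearMap.id Function.injective_id

theorem exists_le_hasConstAnnih (hacc : ACCAnnih R M) {U : Submodule R M} (hU : U ≠ ⊥) :
    ∃ V ≤ U, HasConstAnnih (annih R M V) V := by
  let ι := {V : Submodule R M // V ≤ U ∧ V ≠ ⊥}
  have : Nonempty ι := ⟨⟨U, le_rfl, hU⟩⟩
  obtain ⟨⟨V, hVU, hV⟩, hmax⟩ := hacc.exists_maximal (fun V : ι => annih R M V.1)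
    fun V => annih_mem_annihSet V.1
  refine ⟨V, hVU, Submodule.nontrivial_iff_ne_bot.2 hV, fun L hL => ?_⟩
  have e := annih_congr (M := M) (Submodule.equivMapOfInjective V.subtype V.subtype_injective L)
  rw [e]
  refine hmax ⟨L.map V.subtype, (Submodule.map_subtype_le V L).trans hVU, ?_⟩ ?_
  · exact map_ne_bot_of_injective V.subtype_injective hL
  · exact e ▸ annih_le_of_injective L.subtype L.subtype_injective

/-- A uniform module has at most one associated submodule, the constant annihilator of any of its
submodules that has one. -/
theorem IsUniform.ass_eq (h : IsUniform R X) {P : Submodule R M} (hP : P ≠ ⊤)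
    (hPi : P.IsFullyInvariant) (hV : HasConstAnnih P V) (i : V →ₗ[R] X)
    (hi : Function.Injective i) : Ass R M X = {P} := by
  have := hV.1
  let e := LinearEquiv.ofInjective i hi
  have hr : LinearMap.range i ≠ ⊥ :=
    Submodule.nontrivial_iff_ne_bot.1 e.injective.nontrivial
  have key : ∀ L : Submodule R X, L ≠ ⊥ → L ≤ LinearMap.range i → annih R M L = P := by
    intro L hL hLi
    have := Submodule.nontrivial_iff_ne_bot.2 hL
    exact hV.annih_eq_of_injective (e.symm.toLinearMap ∘ₗ Submodule.inclusion hLi)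
      (e.symm.injective.comp (Submodule.inclusion_injective hLi))
  ext K
  constructor
  · rintro ⟨-, -, L, hL, hK⟩
    have hne := h.2 L _ hL hr
    rw [Set.mem_singleton_iff, ← hK _ hne inf_le_left]
    exact key _ hne inf_le_right
  · rintro rfl
    exact ⟨hP, hPi, _, hr, key⟩

end Uniform

/-! ### Minimal primes -/

theorem HasConstAnnih.isPrimeIn (hproj : IsProjectiveIn R M M) (hsemi : IsSemiprimeModule R M)
    {P U : Submodule R M} (h : HasConstAnnih P U) : IsPrimeIn P := by
  have hU := Submodule.nontrivial_iff_ne_bot.1 h.1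
  refine ⟨h.annih_eq ▸ annih_ne_top hproj hsemi hU, h.annih_eq ▸ annih_fullyInvariant,
    fun K L _ _ hKL => or_iff_not_imp_right.2 fun hL => ?_⟩
  obtain ⟨x, hxL, hx⟩ := SetLike.not_le_iff_exists.1 hL
  rw [← h.annih_eq, mem_annih] at hx
  push Not at hx
  obtain ⟨f, hf⟩ := hx
  have hne : L.map f ≠ ⊥ := fun h0 =>
    hf ((Submodule.mem_bot R).1 (h0 ▸ Submodule.mem_map_of_mem hxL))
  rw [← h.2 _ hne]
  -- A map `M → f(L)` lifts to `M → L`, which sends `K` into `K_M L ≤ P`, and `f` kills `P`.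
  refine fun k hk => mem_annih.2 fun g => ?_
  obtain ⟨t, rfl⟩ := hproj.2 _ _ (InSigma.self.submodule L)
    ((InSigma.self.submodule U).submodule _) (f.submoduleMap L) g (f.submoduleMap_surjective L)
  have h1 : (t k : M) ∈ annih R M U := h.annih_eq ▸ prodSub_le_iff.1 hKL t k hk
  exact Subtype.ext (mem_annih.1 h1 f)

theorem HasConstAnnih.mem_minSpec (hproj : IsProjectiveIn R M M) (hsemi : IsSemiprimeModule R M)
    {P U : Submodule R M} (h : HasConstAnnih P U) : P ∈ MinSpec R M := by
  refine ⟨h.isPrimeIn hproj hsemi, fun Q hQ hQP => ?_⟩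
  refine (hQ.2.2 P (fullyInvariantClosure U) (h.isPrimeIn hproj hsemi).2.1
    (fullyInvariantClosure_fullyInvariant U) (prodSub_le_iff.2 fun f x hx => ?_)).resolve_right
    fun hU => ?_
  · rw [← h.annih_eq] at hx
    simp [mem_annih.1 (annih_le_annih_fullyInvariantClosure hproj U hx) f]
  · refine Submodule.nontrivial_iff_ne_bot.1 h.1 (eq_bot_of_le_annih hproj hsemi ?_)
    rw [h.annih_eq]
    exact ((le_fullyInvariantClosure U).trans hU).trans hQP

/-- A uniform submodule of `M` all of whose nonzero submodules have the same annihilator. -/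
def IsUniformConst (U : Submodule R M) : Prop :=
  IsUniform R U ∧ HasConstAnnih (annih R M U) U

/-- If `U` is not inside `Ann_M(U')`, then some `M → U'` is nonzero, hence injective, on `U`. -/
theorem IsUniformConst.exists_injective (hproj : IsProjectiveIn R M M)
    (hsemi : IsSemiprimeModule R M) (hacc : ACCAnnih R M) {U U' : Submodule R M}
    (hU : IsUniformConst U) (h : ¬ U ≤ annih R M U') :
    ∃ f : U →ₗ[R] U', Function.Injective f := by
  obtain ⟨x, hxU, hx⟩ := SetLike.not_le_iff_exists.1 h
  rw [mem_annih] at hx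
  push Not at hx
  obtain ⟨f, hf⟩ := hx
  refine ⟨f ∘ₗ U.subtype, .of_comp (f := U'.subtype) ?_⟩
  refine hU.1.injective_of_ne_zero hproj hsemi hacc (InSigma.self.submodule U)
    (f := U'.subtype ∘ₗ f ∘ₗ U.subtype) fun h0 => hf (Subtype.ext ?_)
  exact LinearMap.congr_fun h0 ⟨x, hxU⟩

/-- Distinct annihilators `P₀, P₁, …` of submodules `U₀, U₁, …` as in `IsUniformConst` cannot
form a sequence: `Uₙ` lies in `Pᵢ` for `i ≠ n`, but not in `Pₙ`, so the annihilators `⨅ i ≥ n, Pᵢ` would increase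
forever. -/
theorem finite_annih_isUniformConst (hproj : IsProjectiveIn R M M) (hsemi : IsSemiprimeModule R M)
    (hacc : ACCAnnih R M) :
    {P : Submodule R M | ∃ U : Submodule R M, IsUniformConst U ∧ annih R M U = P}.Finite := by
  by_contra hinf
  let e := Set.Infinite.natEmbedding _ hinf
  choose U hU hUP using fun n => (e n).2
  obtain ⟨n, hn⟩ := hacc (fun n => ⨅ i, annih R M (U (n + i)))
    (fun n => iInf_mem_annihSet fun i => annih_mem_annihSet _) fun m n hmn => le_iInf fun i => by
      obtain ⟨k, rfl⟩ := Nat.exists_eq_add_of_le hmn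
      rw [add_assoc]
      exact iInf_le (fun i => annih R M (U (m + i))) (k + i)
  refine Submodule.nontrivial_iff_ne_bot.1 (hU n).1.1 (eq_bot_of_le_annih hproj hsemi ?_)
  calc U n ≤ ⨅ i, annih R M (U (n + 1 + i)) := le_iInf fun i => by
        by_contra hne
        obtain ⟨f, hf⟩ := (hU n).exists_injective hproj hsemi hacc hne
        have := (hU n).1.1
        have h1 := (hU (n + 1 + i)).2.annih_eq_of_injective f hf
        rw [hUP, hUP] at h1
        have := e.injective (Subtype.ext h1)
        omega
    _ = ⨅ i, annih R M (U (n + i)) := hn (n + 1) n.le_succ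
    _ ≤ annih R M (U n) := iInf_le (fun i => annih R M (U (n + i))) 0

theorem exists_isUniformConst_le (hacc : ACCAnnih R M)
    (hunif : ∀ N : Submodule R M, N ≠ ⊥ → ∃ U : Submodule R M, U ≤ N ∧ IsUniform R U)
    {N : Submodule R M} (hN : N ≠ ⊥) : ∃ U ≤ N, IsUniformConst U := by
  obtain ⟨U, hUN, hU⟩ := hunif N hN
  obtain ⟨V, hVU, hV⟩ := exists_le_hasConstAnnih hacc (Submodule.nontrivial_iff_ne_bot.1 hU.1)
  have := hV.1
  exact ⟨V, hVU.trans hUN,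
    hU.of_injective (Submodule.inclusion hVU) (Submodule.inclusion_injective hVU), hV⟩

theorem IsPrimeIn.exists_le_of_finset_inf_le {Q : Submodule R M} (hQ : IsPrimeIn Q)
    (s : Finset (Submodule R M)) (hs : ∀ P ∈ s, P.IsFullyInvariant) (h : s.inf id ≤ Q) :
    ∃ P ∈ s, P ≤ Q := by
  classical
  have hinf (t : Finset (Submodule R M)) (ht : ∀ P ∈ t, P.IsFullyInvariant) :
      (t.inf id).IsFullyInvariant := by
    rw [Finset.inf_id_eq_sInf]
    exact (fullyInvariantSubmodule R M).sInfClosed ht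
  induction s using Finset.induction_on with
  | empty => exact absurd (top_le_iff.1 (by simpa using h)) hQ.1
  | insert P s _ ih =>
    have hP := hs P (Finset.mem_insert_self P s)
    have hs' : ∀ P ∈ s, P.IsFullyInvariant := fun P' h' => hs P' (Finset.mem_insert_of_mem h')
    have hle : prodSub P (s.inf id) ≤ Q := by
      refine le_trans (prodSub_le_iff.2 fun f x hx => ?_) h
      rw [Finset.inf_insert]
      exact ⟨hP ((s.inf id).subtype ∘ₗ f) hx, (f x).2⟩
    obtain h1 | h1 := hQ.2.2 P _ hP (hinf s hs') hle
    · exact ⟨P, Finset.mem_insert_self P s, h1⟩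
    · obtain ⟨P', hP', h2⟩ := ih hs' h1
      exact ⟨P', Finset.mem_insert_of_mem hP', h2⟩

/-- The finitely many annihilators of submodules as in `IsUniformConst` intersect in `0`, since such
a submodule of the intersection would lie in its own annihilator; so each prime contains one of
them. -/
theorem exists_isUniformConst_of_mem_minSpec (hproj : IsProjectiveIn R M M)
    (hsemi : IsSemiprimeModule R M) (hacc : ACCAnnih R M)
    (hunif : ∀ N : Submodule R M, N ≠ ⊥ → ∃ U : Submodule R M, U ≤ N ∧ IsUniform R U)
    {P : Submodule R M} (hP : P ∈ MinSpec R M) :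
    ∃ U : Submodule R M, IsUniformConst U ∧ annih R M U = P := by
  have hfin := finite_annih_isUniformConst hproj hsemi hacc
  have h0 : hfin.toFinset.inf id = ⊥ := by
    by_contra hne
    obtain ⟨U, hUle, hU⟩ := exists_isUniformConst_le hacc hunif hne
    refine Submodule.nontrivial_iff_ne_bot.1 hU.1.1 (eq_bot_of_le_annih hproj hsemi ?_)
    exact hUle.trans (Finset.inf_le (f := id) (hfin.mem_toFinset.2 ⟨U, hU, rfl⟩))
  obtain ⟨Q, hQ, hQP⟩ := hP.1.exists_le_of_finset_inf_le hfin.toFinset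
    (fun Q hQ => by
      obtain ⟨U, -, rfl⟩ := hfin.mem_toFinset.1 hQ
      exact annih_fullyInvariant) (h0 ▸ bot_le)
  obtain ⟨U, hU, rfl⟩ := hfin.mem_toFinset.1 hQ
  exact ⟨U, hU, le_antisymm hQP (hP.2 (hU.2.isPrimeIn hproj hsemi) hQP)⟩

/-! ### Injective objects of `σ[M]` -/

section Injective

variable {V E F : Type v} [AddCommGroup V] [Module R V] [AddCommGroup E] [Module R E]
  [AddCommGroup F] [Module R F]

theorem exists_maximal_disjoint {A B : Submodule R E} (h : Disjoint A B) :
    ∃ C, A ≤ C ∧ Maximal (Disjoint · B) C := by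
  refine zorn_le_nonempty₀ {C | Disjoint C B} (fun c hc hchain y hy => ?_) A h
  exact ⟨sSup c, hchain.directedOn.disjoint_sSup_left.2 hc, fun _ => le_sSup⟩

theorem IsInjectiveIn.of_retract (hF : IsInjectiveIn R M F) (i : E →ₗ[R] F) (p : F →ₗ[R] E)
    (hpi : p ∘ₗ i = LinearMap.id) : IsInjectiveIn R M E := by
  have hp (x : E) : p (i x) = x := LinearMap.congr_fun hpi x
  refine ⟨hF.1.of_surjective p fun x => ⟨i x, hp x⟩, fun A B _ _ _ _ hA hB j f hj => ?_⟩
  obtain ⟨h, hh⟩ := hF.2 A B hA hB j (i ∘ₗ f) hj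
  refine ⟨p ∘ₗ h, LinearMap.ext fun a => ?_⟩
  simpa [hp] using congrArg p (LinearMap.congr_fun hh a)

/-- In an injective object, a submodule `C` that is maximal among those disjoint from some `B` is
a direct summand. With `D ≥ B` maximal among the submodules disjoint from `C`, the inclusion of
`C` extends along `C → E / D` to an endomorphism `h` of `E` with kernel `D`. Then `h(E) ∩ B = 0`,
because its preimage under `h` contains `D` and is disjoint from `C`, so that `h(E) = C`. -/
theorem IsInjectiveIn.exists_isCompl (hE : IsInjectiveIn R M E) {B C : Submodule R E}
    (hC : Maximal (Disjoint · B) C) : ∃ D, IsCompl C D := by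
  obtain ⟨D, hBD, hD⟩ := exists_maximal_disjoint hC.1.symm
  have hj : Function.Injective (D.mkQ ∘ₗ C.subtype) := by
    rw [← LinearMap.ker_eq_bot, LinearMap.ker_comp, Submodule.ker_mkQ,
      ← Submodule.disjoint_iff_comap_eq_bot]
    exact hD.1.symm
  obtain ⟨h', hh'⟩ := hE.2 _ _ (hE.1.submodule C) (hE.1.of_surjective D.mkQ D.mkQ_surjective)
    (D.mkQ ∘ₗ C.subtype) C.subtype hj
  let h : E →ₗ[R] E := h' ∘ₗ D.mkQ
  have hhC (x : E) (hx : x ∈ C) : h x = x := LinearMap.congr_fun hh' ⟨x, hx⟩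
  have hDk : D ≤ LinearMap.ker h := fun x hx => by
    simp [h, (Submodule.Quotient.mk_eq_zero D).2 hx]
  have hdis : Disjoint (LinearMap.range h) B := by
    have h1 : (LinearMap.range h ⊓ B).comap h ≤ D := by
      refine hD.2 (Submodule.disjoint_def.2 fun x hx hxC => ?_) (hDk.trans fun x hx => ?_)
      · exact Submodule.disjoint_def.1 hC.1 x hxC (hhC x hxC ▸ hx.2)
      · rw [Submodule.mem_comap, LinearMap.mem_ker.1 hx]
        exact zero_mem _
    refine Submodule.disjoint_def.2 ?_
    rintro _ ⟨x, rfl⟩ hx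
    exact hDk (h1 ⟨⟨x, rfl⟩, hx⟩)
  have hrC : LinearMap.range h ≤ C := hC.2 hdis fun x hx => ⟨x, hhC x hx⟩
  exact ⟨_, LinearMap.isCompl_of_proj (f := h.codRestrict C fun x => hrC ⟨x, rfl⟩)
    fun x => Subtype.ext (hhC x x.2)⟩

theorem IsInjectiveIn.isUniform (hE : IsInjectiveIn R M E) (h : IsIndecomposable R E) :
    IsUniform R E := by
  refine ⟨h.1, fun A B hA hB hAB => ?_⟩
  obtain ⟨C, hAC, hC⟩ := exists_maximal_disjoint (disjoint_iff.2 hAB)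
  obtain ⟨D, hD⟩ := hE.exists_isCompl hC
  obtain rfl | rfl := h.2 C D hD
  · exact hA (le_bot_iff.1 hAC)
  · have := hC.1
    rw [eq_top_of_isCompl_bot hD, top_disjoint] at this
    exact hB this

theorem IsUniform.isIndecomposable (h : IsUniform R E) : IsIndecomposable R E :=
  ⟨h.1, fun A B hAB => by
    by_contra! hne
    exact h.2 A B hne.1 hne.2 hAB.inf_eq_bot⟩

/-- Two uniform injective objects with a common nonzero submodule are isomorphic. -/
theorem IsInjectiveIn.nonempty_linearEquiv (hE : IsInjectiveIn R M E) (hEu : IsUniform R E)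
    (hF : IsInjectiveIn R M F) (hFu : IsUniform R F) [Nontrivial V] (i : V →ₗ[R] E)
    (hi : Function.Injective i) (f : V →ₗ[R] F) (hf : Function.Injective f) :
    Nonempty (E ≃ₗ[R] F) := by
  obtain ⟨v, hv⟩ := exists_ne (0 : V)
  obtain ⟨h, rfl⟩ := hF.2 V E (hE.1.of_injective i hi) hE.1 i f hi
  have hr : LinearMap.range i ≠ ⊥ := fun h0 => by
    have : i v ∈ LinearMap.range i := ⟨v, rfl⟩
    rw [h0, Submodule.mem_bot] at this
    exact hv (hi (by simpa using this))
  have hinj : Function.Injective h := by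
    refine LinearMap.ker_eq_bot.1 (hEu.isEssential hr _ (eq_bot_iff.2 ?_))
    rintro _ ⟨hx, w, rfl⟩
    have hw : w = 0 := hf (by simpa using hx)
    simp [hw]
  obtain ⟨p, hp⟩ := hE.2 E F hE.1 hF.1 h LinearMap.id hinj
  have hp (x : E) : p (h x) = x := LinearMap.congr_fun hp x
  have hpinj : Function.Injective p := by
    have hrh : LinearMap.range h ≠ ⊥ := fun h0 => by
      have : h (i v) ∈ LinearMap.range h := ⟨_, rfl⟩
      rw [h0, Submodule.mem_bot] at this
      exact hv (hf (by simpa using this))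
    refine LinearMap.ker_eq_bot.1 (hFu.isEssential hrh _ (eq_bot_iff.2 ?_))
    rintro _ ⟨hx, w, rfl⟩
    have hw : w = 0 := (hp w).symm.trans hx
    simp [hw]
  exact ⟨(LinearEquiv.ofBijective p ⟨hpinj, fun x => ⟨h x, hp x⟩⟩).symm⟩

variable (M) in
/-- The largest submodule of `E` that belongs to `σ[M]`. -/
def sigmaTrace (E : Type v) [AddCommGroup E] [Module R E] : Submodule R E :=
  sSup {N | InSigma R M N}

theorem inSigma_sigmaTrace : InSigma R M (sigmaTrace (R := R) M E) := by
  classical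
  let ι := {N : Submodule R E // InSigma R M N}
  let g : DirectSum ι (fun N => N.1) →ₗ[R] E :=
    DirectSum.toModule R ι E fun N => N.1.subtype
  have hg : sigmaTrace M E = LinearMap.range g := by
    refine le_antisymm (sSup_le fun N hN x hx => ?_) ?_
    · exact ⟨DirectSum.lof R ι (fun N => N.1) ⟨N, hN⟩ ⟨x, hx⟩, by simp [g]⟩
    · rintro _ ⟨x, rfl⟩
      induction x using DirectSum.induction_on with
      | zero => simp
      | of N x =>
        refine (le_sSup N.2 : N.1 ≤ sigmaTrace M E) ?_
        rw [← DirectSum.lof_eq_of R]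
        simp [g]
      | add x y hx hy =>
        rw [map_add]
        exact add_mem hx hy
  rw [hg]
  exact (InSigma.directSum fun N : ι => N.2).range g

theorem isInjectiveIn_sigmaTrace [Module.Injective R E] :
    IsInjectiveIn R M (sigmaTrace (R := R) M E) := by
  refine ⟨inSigma_sigmaTrace, fun A B _ _ _ _ _ hB i f hi => ?_⟩
  obtain ⟨h, hh⟩ := Module.Injective.out i hi ((sigmaTrace M E).subtype ∘ₗ f)
  have hr : LinearMap.range h ≤ sigmaTrace M E := le_sSup (hB.range h)
  exact ⟨h.codRestrict _ fun x => hr ⟨x, rfl⟩, LinearMap.ext fun a => Subtype.ext (hh a)⟩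

variable (R V) in
theorem exists_injective_module [Small.{v} R] :
    ∃ (I : Type v) (_ : AddCommGroup I) (_ : Module R I) (j : V →ₗ[R] I),
      Module.Injective R I ∧ Function.Injective j := by
  obtain ⟨J, _, f, _⟩ := CategoryTheory.EnoughInjectives.presentation (ModuleCat.of R V)
  have : CategoryTheory.Injective (ModuleCat.of R J) := ‹_›
  exact ⟨J, _, _, f.hom, Module.injective_module_of_injective_object R J,
    (ModuleCat.mono_iff_injective f).1 ‹_›⟩

/-- A uniform module of `σ[M]` embeds in a uniform injective object: take an injective module,
pass to its largest submodule `T` in `σ[M]`, and inside `T` to a maximal submodule `C ≥ V` disjoint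
from a fixed maximal `B` disjoint from `V`. -/
theorem IsUniform.exists_injective_hull [Small.{v} R] (hV : IsUniform R V) (h : InSigma R M V) :
    ∃ (E : Type v) (_ : AddCommGroup E) (_ : Module R E) (i : V →ₗ[R] E),
      IsInjectiveIn R M E ∧ IsUniform R E ∧ Function.Injective i := by
  obtain ⟨I, _, _, j, _, hj⟩ := exists_injective_module R V
  obtain ⟨T, k, hT, hk⟩ : ∃ (T : Submodule R I) (k : V →ₗ[R] T),
      IsInjectiveIn R M T ∧ Function.Injective k := by
    have hr : LinearMap.range j ≤ sigmaTrace M I := le_sSup (h.range j)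
    exact ⟨sigmaTrace M I, j.codRestrict _ fun x => hr ⟨x, rfl⟩, isInjectiveIn_sigmaTrace,
      fun a b hab => hj (congrArg Subtype.val hab)⟩
  let U := LinearMap.range k
  obtain ⟨B, -, hB⟩ := exists_maximal_disjoint (disjoint_bot_left : Disjoint ⊥ U)
  obtain ⟨C, hUC, hC⟩ := exists_maximal_disjoint hB.1.symm
  obtain ⟨D, hCD⟩ := hT.exists_isCompl hC
  -- `U` is essential in `C`: if `N ≤ C` and `N ∩ U = 0`, then `(N + B) ∩ U = 0`, hence `N ≤ B`.
  have hess (N : Submodule R T) (hNC : N ≤ C) (hNU : Disjoint N U) : N = ⊥ := by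
    have h1 : N ⊔ B ≤ B := hB.2 (Submodule.disjoint_def.2 fun x hx hxU => by
      obtain ⟨n, hn, b, hb, rfl⟩ := Submodule.mem_sup.1 hx
      have hb0 : b = 0 := Submodule.disjoint_def.1 hC.1 b
        ((C.add_mem_iff_right (hNC hn)).1 (hUC hxU)) hb
      subst hb0
      rw [add_zero] at hxU ⊢
      exact Submodule.disjoint_def.1 hNU n hn hxU) le_sup_right
    exact le_bot_iff.1 (hC.1 hNC (le_sup_left.trans h1))
  let i : V →ₗ[R] C := k.codRestrict C fun x => hUC ⟨x, rfl⟩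
  have hi : Function.Injective i := fun a b hab => hk (congrArg Subtype.val hab)
  refine ⟨C, _, _, i, hT.of_retract C.subtype (C.projectionOnto D hCD)
    (LinearMap.ext fun x => by simp), hV.of_isEssential_range i hi fun N hN => ?_, hi⟩
  by_contra hne
  refine map_ne_bot_of_injective C.subtype_injective hne
    (hess _ (Submodule.map_subtype_le C N) (Submodule.disjoint_def.2 ?_))
  rintro _ ⟨n, hn, rfl⟩ ⟨x, hx⟩
  have : n ∈ N ⊓ LinearMap.range i := ⟨hn, x, Subtype.ext hx⟩
  rw [hN, Submodule.mem_bot] at this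
  simp [this]

/-- A uniform module of `σ[M]` with a nonzero submodule isomorphic to one of `M` is
`χ(M)`-torsion-free. -/
theorem IsUniform.chi_torsionFree (hE : IsUniform R E) (h : InSigma R M E) [Nontrivial V]
    (i : V →ₗ[R] E) (hi : Function.Injective i) (k : V →ₗ[R] M) (hk : Function.Injective k) :
    (chi R M).TorsionFree E := by
  refine ⟨h, fun T _ _ hT f => ?_⟩
  rw [← LinearMap.range_eq_bot]
  have hess : IsEssential (LinearMap.range i) := by
    refine hE.isEssential fun h0 => ?_
    obtain ⟨v, hv⟩ := exists_ne (0 : V)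
    exact hv (hi (by rw [LinearMap.range_eq_bot.1 h0]; simp))
  refine hess _ (eq_bot_iff.2 ?_)
  rintro _ ⟨hx, v, rfl⟩
  have hT' : ChiTorsion R M (LinearMap.range f) :=
    (chi R M).of_surjective _ _ f.rangeRestrict f.surjective_rangeRestrict hT
  let W := (LinearMap.range f).comap i
  let q : W →ₗ[R] LinearMap.range f := i.restrict fun _ hx => hx
  have hq : Function.Injective q := fun a b hab => Subtype.ext (hi (congrArg Subtype.val hab))
  have h0 := LinearMap.congr_fun (hT'.hom_eq_zero q hq (k ∘ₗ W.subtype)) ⟨v, hx⟩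
  have hv : v = 0 := hk (by simpa using h0)
  simp [hv]

/-- A `χ(M)`-torsion-free uniform module is not torsion, so a submodule of it has a nonzero map to
`M`, which is injective. -/
theorem IsUniform.exists_isUniformConst (hproj : IsProjectiveIn R M M)
    (hsemi : IsSemiprimeModule R M) (hacc : ACCAnnih R M) (hE : IsUniform R E)
    (h : (chi R M).TorsionFree E) :
    ∃ (U : Submodule R M) (i : U →ₗ[R] E), IsUniformConst U ∧ Function.Injective i := by
  have := hE.1
  obtain ⟨X, f, hf⟩ : ∃ (X : Submodule R E) (f : X →ₗ[R] M), f ≠ 0 := by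
    by_contra! hne
    obtain ⟨x, hx⟩ := exists_ne (0 : E)
    exact hx (LinearMap.congr_fun (h.2 E ⟨h.1, hne⟩ LinearMap.id) x)
  have hX : Nontrivial X := by
    by_contra hs
    rw [not_nontrivial_iff_subsingleton] at hs
    exact hf (Subsingleton.elim _ _)
  have hXu := hE.of_injective X.subtype X.subtype_injective
  have hinj := hXu.injective_of_ne_zero hproj hsemi hacc (h.1.submodule X) hf
  obtain ⟨U, hU, hUc⟩ := exists_le_hasConstAnnih hacc (LinearMap.range_eq_bot.not.2 hf)
  let e := LinearEquiv.ofInjective f hinj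
  let i : U →ₗ[R] X := e.symm.toLinearMap ∘ₗ Submodule.inclusion hU
  have hi : Function.Injective i := e.symm.injective.comp (Submodule.inclusion_injective hU)
  have := hUc.1
  exact ⟨U, X.subtype ∘ₗ i, ⟨hXu.of_injective i hi, hUc⟩, X.subtype_injective.comp hi⟩

end Injective

/-! ### The correspondence with the minimal primes -/

theorem IsUniformConst.ass_eq (hproj : IsProjectiveIn R M M) (hsemi : IsSemiprimeModule R M)
    {U : Submodule R M} (hU : IsUniformConst U) {E : Type v} [AddCommGroup E] [Module R E]
    (hE : IsUniform R E) (i : U →ₗ[R] E) (hi : Function.Injective i) :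
    Ass R M E = {annih R M U} :=
  hE.ass_eq (hU.2.isPrimeIn hproj hsemi).1 annih_fullyInvariant hU.2 i hi

theorem IndecInj.isUniform {τ : HereditaryTorsionTheory R M} (E : IndecInj R M τ) :
    IsUniform R E.carrier :=
  E.injective.isUniform E.indecomposable

theorem IndecInj.exists_ass_eq (hproj : IsProjectiveIn R M M) (hsemi : IsSemiprimeModule R M)
    (hacc : ACCAnnih R M) (E : IndecInj R M (chi R M)) :
    ∃ P : MinSpec R M, Ass R M E.carrier = {(P : Submodule R M)} := by
  obtain ⟨U, i, hU, hi⟩ := E.isUniform.exists_isUniformConst hproj hsemi hacc E.torsionFree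
  exact ⟨⟨_, hU.2.mem_minSpec hproj hsemi⟩, hU.ass_eq hproj hsemi E.isUniform i hi⟩

/-- Each of `E`, `F` contains a uniform submodule of `M` with annihilator the associated prime `P`,
say `U` and `U'`. As `U` is not inside `P = Ann_M(U')`, it embeds into `U'`. -/
theorem IndecInj.equiv_iff_ass_eq (hproj : IsProjectiveIn R M M) (hsemi : IsSemiprimeModule R M)
    (hacc : ACCAnnih R M) (E F : IndecInj R M (chi R M)) :
    E ≈ F ↔ Ass R M E.carrier = Ass R M F.carrier := by
  obtain ⟨U, i, hU, hi⟩ := E.isUniform.exists_isUniformConst hproj hsemi hacc E.torsionFree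
  rw [hU.ass_eq hproj hsemi E.isUniform i hi]
  constructor
  · rintro ⟨e⟩
    exact (hU.ass_eq hproj hsemi F.isUniform (e.toLinearMap ∘ₗ i) (e.injective.comp hi)).symm
  · intro h
    obtain ⟨U', i', hU', hi'⟩ :=
      F.isUniform.exists_isUniformConst hproj hsemi hacc F.torsionFree
    rw [hU'.ass_eq hproj hsemi F.isUniform i' hi', Set.singleton_eq_singleton_iff] at h
    obtain ⟨f, hf⟩ := hU.exists_injective hproj hsemi hacc (U' := U') fun hle =>
      Submodule.nontrivial_iff_ne_bot.1 hU.1.1 (eq_bot_of_le_annih hproj hsemi (h ▸ hle))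
    have := hU.1.1
    exact E.injective.nonempty_linearEquiv E.isUniform F.injective F.isUniform i hi
      (i' ∘ₗ f) (hi'.comp hf)

theorem exists_indecInj_ass_eq [Small.{v} R] (hproj : IsProjectiveIn R M M)
    (hsemi : IsSemiprimeModule R M) (hacc : ACCAnnih R M)
    (hunif : ∀ N : Submodule R M, N ≠ ⊥ → ∃ U : Submodule R M, U ≤ N ∧ IsUniform R U)
    {P : Submodule R M} (hP : P ∈ MinSpec R M) :
    ∃ E : IndecInj R M (chi R M), Ass R M E.carrier = {P} := by
  obtain ⟨U, hU, rfl⟩ := exists_isUniformConst_of_mem_minSpec hproj hsemi hacc hunif hP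
  obtain ⟨E, _, _, i, hE, hEu, hi⟩ := hU.1.exists_injective_hull (InSigma.self.submodule U)
  have := hU.1.1
  exact ⟨⟨ModuleCat.of R E, hEu.isIndecomposable,
    hEu.chi_torsionFree hE.1 i hi U.subtype U.subtype_injective, hE⟩,
    hU.ass_eq hproj hsemi hEu i hi⟩

end SigmaCat

theorem theorem2p7 (R : Type u) [Ring R] [Small.{v} R] (M : Type v) [AddCommGroup M] [Module R M]
    (hproj : SigmaCat.IsProjectiveIn R M M)
    (hsemi : SigmaCat.IsSemiprimeModule R M)
    (hacc : SigmaCat.ACCAnnih R M)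
    (hunif : ∀ N : Submodule R M, N ≠ ⊥ →
      ∃ U : Submodule R M, U ≤ N ∧ SigmaCat.IsUniform R U) :
    (∀ (X : Type v) [AddCommGroup X] [Module R X], SigmaCat.InSigma R M X →
      ((SigmaCat.chi R M).TorsionFree X ↔ SigmaCat.IsNonsingularIn R M X)) ∧
    ∃ Ψ : SigmaCat.IndecInjClasses (SigmaCat.chi R M) → SigmaCat.MinSpec R M,
      Function.Bijective Ψ ∧
      ∀ E : SigmaCat.IndecInj R M (SigmaCat.chi R M),
        SigmaCat.Ass R M E.carrier = {(Ψ ⟦E⟧ : Submodule R M)} := by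
  refine ⟨fun X _ _ _ => SigmaCat.chi_torsionFree_iff_isNonsingularIn hproj hsemi hacc, ?_⟩
  choose ψ hψ using SigmaCat.IndecInj.exists_ass_eq hproj hsemi hacc
  have hiff (E F : SigmaCat.IndecInj R M (SigmaCat.chi R M)) : E ≈ F ↔ ψ E = ψ F := by
    rw [SigmaCat.IndecInj.equiv_iff_ass_eq hproj hsemi hacc, hψ, hψ,
      Set.singleton_eq_singleton_iff, Subtype.coe_inj]
  refine ⟨Quotient.lift ψ fun E F => (hiff E F).1, ⟨?_, fun P => ?_⟩, hψ⟩
  · rintro ⟨E⟩ ⟨F⟩ h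
    exact Quotient.sound ((hiff E F).2 h)
  · obtain ⟨E, hE⟩ := SigmaCat.exists_indecInj_ass_eq hproj hsemi hacc hunif P.2
    rw [hψ, Set.singleton_eq_singleton_iff, Subtype.coe_inj] at hE
    exact ⟨⟦E⟧, hE⟩
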